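/- Let $A\in\mathbb R^{m\times m}$, $B\in\mathbb R^{m\times n}$, $C\in\mathbb R^{n\times m}$, $D\in\mathbb R^{n\times n}$, and put $$K=\begin{bmatrix} D & -C\\ -B & A\end{bmatrix},\qquad H=\begin{bmatrix} D & -C\\ B & -A\end{bmatrix}.$$ All inequalities between matrices or vectors are entrywise, and $\rho$ denotes the spectral radius. A real square matrix with nonpositive off-diagonal entries is called an $M$-matrix if it can be written as $sI-N$ with $N\ge 0$ and $s\ge\rho(N)$; it is a singular $M$-matrix if $s=\rho(N)$ and a nonsingular $M$-matrix if $s>\rho(N)$. An $M$-matrix $M$ is regular if $Mw\ge 0$ for some vector $w>0$. Suppose that $K$ is a regular singular $M$-matrix and that the null space of $H$ is one-dimensional. Let $u_1,v_1\in\mathbb R^n$ and $u_2,v_2\in\mathbb R^m$ be such that $\begin{bmatrix}u_1\\u_2\end{bmatrix}$ and $\begin{bmatrix}v_1\\v_2\end{bmatrix}$ are nonnegative and nonzero and $$K\begin{bmatrix}v_1\\v_2\end{bmatrix}=0,\qquad [u_1^T\;\,u_2^T]\,K=0 .$$ Let $\Phi\in\mathbb R^{m\times n}$ be the minimal nonnegative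 solution of $XCX-XD-AX+B=0$ and let $\Psi\in\mathbb R^{n\times m}$ be the minimal nonnegative solution of the dual equation $YBY-YA-DY+C=0$ (a nonnegative solution is minimal if it is $\le$ every nonnegative solution). If $u_1^Tv_1\ne u_2^Tv_2$ and at least one of $\Phi$ and $\Psi$ is positive (all entries are $>0$), then $I_m-\Phi\Psi$ and $I_n-\Psi\Phi$ are nonsingular $M$-matrices, and $\rho(\Phi\Psi)<1$. -/

import Mathlib

open scoped Matrix

noncomputable section

/-- The spectral radius `ρ(A)` of a real square matrix: the largest modulus of its
complex eigenvalues. -/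
def realSpectralRadius {ι : Type*} [Fintype ι] [DecidableEq ι] (A : Matrix ι ι ℝ) : ℝ :=
  (spectralRadius ℂ (A.map Complex.ofReal)).toReal

/-- Entrywise nonnegative matrices. -/
def EntrywiseNonneg {ι κ : Type*} (A : Matrix ι κ ℝ) : Prop :=
  ∀ i j, 0 ≤ A i j

/-- Entrywise (strictly) positive matrices. -/
def EntrywisePos {ι κ : Type*} (A : Matrix ι κ ℝ) : Prop :=
  ∀ i j, 0 < A i j

/-- A `Z`-matrix: all off-diagonal entries are nonpositive. -/
def IsZMatrix {ι : Type*} (A : Matrix ι ι ℝ) : Prop :=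
  ∀ i j, i ≠ j → A i j ≤ 0

/-- An `M`-matrix: a `Z`-matrix `s I - B` with `B ≥ 0` and `s ≥ ρ(B)`. -/
def IsMMatrix {ι : Type*} [Fintype ι] [DecidableEq ι] (A : Matrix ι ι ℝ) : Prop :=
  IsZMatrix A ∧ ∃ (s : ℝ) (B : Matrix ι ι ℝ),
    EntrywiseNonneg B ∧ A = s • (1 : Matrix ι ι ℝ) - B ∧ realSpectralRadius B ≤ s

/-- A singular `M`-matrix: a `Z`-matrix `s I - B` with `B ≥ 0` and `s = ρ(B)`. -/
def IsSingularMMatrix {ι : Type*} [Fintype ι] [DecidableEq ι] (A : Matrix ι ι ℝ) : Prop :=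
  IsZMatrix A ∧ ∃ (s : ℝ) (B : Matrix ι ι ℝ),
    EntrywiseNonneg B ∧ A = s • (1 : Matrix ι ι ℝ) - B ∧ s = realSpectralRadius B

/-- A nonsingular `M`-matrix: a `Z`-matrix `s I - B` with `B ≥ 0` and `s > ρ(B)`. -/
def IsNonsingularMMatrix {ι : Type*} [Fintype ι] [DecidableEq ι] (A : Matrix ι ι ℝ) : Prop :=
  IsZMatrix A ∧ ∃ (s : ℝ) (B : Matrix ι ι ℝ),
    EntrywiseNonneg B ∧ A = s • (1 : Matrix ι ι ℝ) - B ∧ realSpectralRadius B < s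

/-- A regular `M`-matrix: an `M`-matrix `A` with `A v ≥ 0` for some entrywise positive `v`. -/
def IsRegularMMatrix {ι : Type*} [Fintype ι] [DecidableEq ι] (A : Matrix ι ι ℝ) : Prop :=
  IsMMatrix A ∧ ∃ v : ι → ℝ, (∀ i, 0 < v i) ∧ ∀ i, 0 ≤ (A *ᵥ v) i

/-- The block matrix `K = [D, -C; -B, A]`. -/
def blockK {m n : ℕ} (A : Matrix (Fin m) (Fin m) ℝ) (B : Matrix (Fin m) (Fin n) ℝ)
    (C : Matrix (Fin n) (Fin m) ℝ) (D : Matrix (Fin n) (Fin n) ℝ) :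
    Matrix (Fin n ⊕ Fin m) (Fin n ⊕ Fin m) ℝ :=
  Matrix.fromBlocks D (-C) (-B) A

/-- The block matrix `H = [D, -C; B, -A]`. -/
def blockH {m n : ℕ} (A : Matrix (Fin m) (Fin m) ℝ) (B : Matrix (Fin m) (Fin n) ℝ)
    (C : Matrix (Fin n) (Fin m) ℝ) (D : Matrix (Fin n) (Fin n) ℝ) :
    Matrix (Fin n ⊕ Fin m) (Fin n ⊕ Fin m) ℝ :=
  Matrix.fromBlocks D (-C) B (-A)

/-- `X` solves the algebraic Riccati equation `X C X - X D - A X + B = 0`. -/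
def SolvesRiccati {m n : ℕ} (A : Matrix (Fin m) (Fin m) ℝ) (B : Matrix (Fin m) (Fin n) ℝ)
    (C : Matrix (Fin n) (Fin m) ℝ) (D : Matrix (Fin n) (Fin n) ℝ)
    (X : Matrix (Fin m) (Fin n) ℝ) : Prop :=
  X * C * X - X * D - A * X + B = 0

/-- `X` is the minimal nonnegative solution of `X C X - X D - A X + B = 0`: a nonnegative
solution that is entrywise below every nonnegative solution. The minimal nonnegative solution
of the dual equation `Y B Y - Y A - D Y + C = 0` is obtained by exchanging
`(A, B)` with `(D, C)`. -/
def IsMinimalNonnegSolution {m n : ℕ} (A : Matrix (Fin m) (Fin m) ℝ)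
    (B : Matrix (Fin m) (Fin n) ℝ) (C : Matrix (Fin n) (Fin m) ℝ)
    (D : Matrix (Fin n) (Fin n) ℝ) (X : Matrix (Fin m) (Fin n) ℝ) : Prop :=
  EntrywiseNonneg X ∧ SolvesRiccati A B C D X ∧
    ∀ Y : Matrix (Fin m) (Fin n) ℝ, EntrywiseNonneg Y → SolvesRiccati A B C D Y →
      ∀ i j, X i j ≤ Y i j

end

/-! ### Z-matrices, nonnegative matrices and bounds on their eigenvalues. -/

section GeneralMatrices

variable {ι κ μ : Type*}

/-! Regularity of `K` supplies `w = (w₁, w₂) > 0` with `K w ≥ 0`. Monotone iteration gives `Φ w₁ ≤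
w₂` and `Ψ w₂ ≤ w₁`, so `ΦΨ w₂ ≤ w₂` and likewise `ΨΦ w₁ ≤ w₁`. By `realSpectralRadius_lt_one` it
remains only to exclude the eigenvalue `1` of `ΦΨ`, which is `det_one_sub_mul_ne_zero`.

The spectra of `D - CΦ`, `A - ΦC`, `A - BΨ`, `D - ΨB` lie in a disc that meets the imaginary axis
only at `0`. If `1 - ΦΨ` is singular, its kernel is invariant under `A - BΨ`, and an eigenvector `x`
there with eigenvalue `r` makes `Ψx` an eigenvector of `D - CΦ` with eigenvalue `-r`. Hence `r = 0`
and `(Ψx, x)` lies in the kernel of `H`. That kernel is a line containing `(v₁, v₂)`, so `Ψv₂ = v₁`,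
`Φv₁ = v₂`, and `D - CΦ` is singular.

Each of `Φ` and `Ψ` block-triangularizes `H`, and counting eigenvalues of `H` in the open right
half-plane (`false_of_mul_eq_mul`) forces `D - ΨB` to be singular too. A left null vector of it
yields a left null vector of `H`, proportional to `(u₁, -u₂)`, so `u₂ = u₁Ψ`. Then `u₂ᵀv₂ = u₁ᵀΨv₂ =
u₁ᵀv₁`, contradicting the nonzero drift. -/

theorem EntrywiseNonneg.mul [Fintype ι] {N : Matrix μ ι ℝ} {P : Matrix ι κ ℝ} (hN : EntrywiseNonneg N)
    (hP : EntrywiseNonneg P) : EntrywiseNonneg (N * P) := fun i j => by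
  rw [Matrix.mul_apply]
  exact Finset.sum_nonneg fun k _ => mul_nonneg (hN i k) (hP k j)

theorem EntrywiseNonneg.add {N P : Matrix μ ι ℝ} (hN : EntrywiseNonneg N)
    (hP : EntrywiseNonneg P) : EntrywiseNonneg (N + P) :=
  fun i j => add_nonneg (hN i j) (hP i j)

theorem EntrywiseNonneg.smul {N : Matrix μ ι ℝ} {t : ℝ} (ht : 0 ≤ t)
    (hN : EntrywiseNonneg N) : EntrywiseNonneg (t • N) :=
  fun i j => mul_nonneg ht (hN i j)

variable [Fintype ι]

theorem EntrywiseNonneg.mulVec_nonneg {N : Matrix μ ι ℝ} {x : ι → ℝ} (hN : EntrywiseNonneg N)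
    (hx : ∀ i, 0 ≤ x i) (i : μ) : 0 ≤ (N *ᵥ x) i :=
  Finset.sum_nonneg fun k _ => mul_nonneg (hN i k) (hx k)

theorem EntrywiseNonneg.vecMul_nonneg {N : Matrix ι μ ℝ} {x : ι → ℝ} (hN : EntrywiseNonneg N)
    (hx : ∀ i, 0 ≤ x i) (i : μ) : 0 ≤ (x ᵥ* N) i :=
  Finset.sum_nonneg fun k _ => mul_nonneg (hx k) (hN k i)

/-- A `Z`-matrix that maps some positive vector to a nonnegative one only attains positive
vectors at positive vectors. -/
theorem IsZMatrix.pos_of_mulVec_pos {M : Matrix ι ι ℝ} (hM : IsZMatrix M) {w z : ι → ℝ}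
    (hw : ∀ i, 0 < w i) (hMw : ∀ i, 0 ≤ (M *ᵥ w) i) (hMz : ∀ i, 0 < (M *ᵥ z) i) :
    ∀ i, 0 < z i := by
  by_contra! h
  obtain ⟨i₁, hi₁⟩ := h
  have : Nonempty ι := ⟨i₁⟩
  -- Add the least multiple `σ` of `w` that makes `z + σ w` nonnegative. It vanishes at the
  -- maximizing index, where the sign pattern of `M` then contradicts positivity.
  obtain ⟨i, hi⟩ := Finite.exists_max fun i => -z i / w i
  set σ := -z i / w i with hσ
  have hσ0 : 0 ≤ σ := le_trans (div_nonneg (by linarith) (hw i₁).le) (hi i₁)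
  have hy : ∀ j, 0 ≤ (z + σ • w) j := fun j => by
    have := (div_le_iff₀ (hw j)).1 (hi j)
    simp only [Pi.add_apply, Pi.smul_apply, smul_eq_mul]
    linarith
  have hyi : (z + σ • w) i = 0 := by
    simp only [Pi.add_apply, Pi.smul_apply, smul_eq_mul, hσ]
    field_simp [(hw i).ne']
    ring
  have h1 : 0 < (M *ᵥ (z + σ • w)) i := by
    rw [Matrix.mulVec_add, Matrix.mulVec_smul]
    exact add_pos_of_pos_of_nonneg (hMz i) (mul_nonneg hσ0 (hMw i))
  refine absurd h1 (not_lt.2 (Finset.sum_nonpos fun j _ => ?_))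
  by_cases hij : i = j
  · rw [← hij, hyi, mul_zero]
  · exact mul_nonpos_of_nonpos_of_nonneg (hM i j hij) (hy j)

theorem IsZMatrix.nonneg_of_mulVec_nonneg {M : Matrix ι ι ℝ} (hM : IsZMatrix M) {w z : ι → ℝ}
    (hw : ∀ i, 0 < w i) (hMw : ∀ i, 0 < (M *ᵥ w) i) (hMz : ∀ i, 0 ≤ (M *ᵥ z) i) (i : ι) :
    0 ≤ z i := by
  refine le_of_forall_pos_le_add fun ε hε => ?_
  have := hM.pos_of_mulVec_pos (z := z + (ε / w i) • w) hw (fun i => (hMw i).le) (fun j => by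
    rw [Matrix.mulVec_add, Matrix.mulVec_smul]
    exact add_pos_of_nonneg_of_pos (hMz j) (mul_pos (div_pos hε (hw i)) (hMw j))) i
  simp only [Pi.add_apply, Pi.smul_apply, smul_eq_mul, div_mul_cancel₀ _ (hw i).ne'] at this
  exact this.le

variable [DecidableEq ι]

/-- A semipositive `Z`-matrix is also semipositive from the left. -/
theorem IsZMatrix.exists_vecMul_pos {M : Matrix ι ι ℝ} (hM : IsZMatrix M) {w : ι → ℝ}
    (hw : ∀ i, 0 < w i) (hMw : ∀ i, 0 < (M *ᵥ w) i) :
    ∃ u : ι → ℝ, (∀ i, 0 < u i) ∧ ∀ i, 0 < (u ᵥ* M) i := by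
  have hdet : M.det ≠ 0 := fun h => by
    obtain ⟨z, hz, hMz⟩ := Matrix.exists_mulVec_eq_zero_iff.2 h
    refine hz (funext fun i => le_antisymm ?_ ?_)
    · have := hM.nonneg_of_mulVec_nonneg (z := -z) hw hMw (by simp [Matrix.mulVec_neg, hMz]) i
      simpa using this
    · exact hM.nonneg_of_mulVec_nonneg hw hMw (by simp [hMz]) i
  have hunit : IsUnit M.det := isUnit_iff_ne_zero.2 hdet
  -- Each column of `M⁻¹` is sent by `M` to a nonnegative unit vector; the wanted left vector is
  -- then the vector of column sums of `M⁻¹`.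
  have hinv : EntrywiseNonneg M⁻¹ := fun i j => by
    refine hM.nonneg_of_mulVec_nonneg (z := M⁻¹.col j) hw hMw (fun k => ?_) i
    have : M *ᵥ M⁻¹.col j = (M * M⁻¹).col j := rfl
    rw [this, Matrix.mul_nonsing_inv _ hunit, Matrix.col_apply, Matrix.one_apply]
    split_ifs <;> norm_num
  have huM : (1 ᵥ* M⁻¹) ᵥ* M = (1 : ι → ℝ) := by
    rw [Matrix.vecMul_vecMul, Matrix.nonsing_inv_mul _ hunit, Matrix.vecMul_one]
  have hu : ∀ i, 0 ≤ ((1 : ι → ℝ) ᵥ* M⁻¹) i := hinv.vecMul_nonneg fun i => zero_le_one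
  refine ⟨1 ᵥ* M⁻¹, fun j => lt_of_le_of_ne (hu j) fun h => ?_, fun i => by simp [huM]⟩
  have h1 : ((1 ᵥ* M⁻¹) ᵥ* M) j = (1 : ℝ) := by rw [huM]; rfl
  have h2 : ((1 ᵥ* M⁻¹) ᵥ* M) j ≤ (0 : ℝ) := Finset.sum_nonpos fun i _ => by
    by_cases hij : i = j
    · rw [hij, ← h, zero_mul]
    · exact mul_nonpos_of_nonneg_of_nonpos (hu i) (hM i j hij)
  linarith

theorem isRoot_charpoly_iff {R : Type*} [CommRing R] [IsDomain R] {M : Matrix ι ι R} {r : R} :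
    M.charpoly.IsRoot r ↔ ∃ x ≠ 0, M *ᵥ x = r • x := by
  rw [Polynomial.IsRoot.def, Matrix.eval_charpoly, ← Matrix.exists_mulVec_eq_zero_iff]
  refine exists_congr fun x => and_congr_right fun _ => ?_
  rw [Matrix.sub_mulVec, sub_eq_zero, eq_comm, Matrix.scalar_apply,
    ← Matrix.smul_one_eq_diagonal, Matrix.smul_mulVec, Matrix.one_mulVec]

/-- A subinvariant positive vector bounds the eigenvalues of a nonnegative matrix. -/
theorem norm_le_of_isRoot_charpoly {N : Matrix ι ι ℝ} (hN : EntrywiseNonneg N) {w : ι → ℝ} {t : ℝ}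
    (hw : ∀ i, 0 < w i) (hNw : ∀ i, (N *ᵥ w) i ≤ t * w i) {r : ℂ}
    (hr : (N.map Complex.ofReal).charpoly.IsRoot r) : ‖r‖ ≤ t := by
  obtain ⟨x, hx0, hx⟩ := isRoot_charpoly_iff.1 hr
  -- Compare the eigenvector with `w` at an index where the weighted sup norm `max |x i| / w i` is
  -- attained.
  obtain ⟨i₁, hi₁⟩ := Function.ne_iff.1 hx0
  have : Nonempty ι := ⟨i₁⟩
  obtain ⟨i, hi⟩ := Finite.exists_max fun i => ‖x i‖ / w i
  set ρ := ‖x i‖ / w i with hρ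
  have hρ0 : 0 < ρ := lt_of_lt_of_le (div_pos (norm_pos_iff.2 hi₁) (hw i₁)) (hi i₁)
  have hxi : ‖x i‖ = ρ * w i := (div_mul_cancel₀ _ (hw i).ne').symm
  have h1 : ‖r‖ * (ρ * w i) ≤ t * (ρ * w i) := calc
    ‖r‖ * (ρ * w i) = ‖(r • x) i‖ := by rw [Pi.smul_apply, norm_smul, hxi]
    _ = ‖∑ j, (N i j : ℂ) * x j‖ := by rw [← hx]; rfl
    _ ≤ ∑ j, N i j * (ρ * w j) := by
      refine (norm_sum_le _ _).trans (Finset.sum_le_sum fun j _ => ?_)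
      rw [norm_mul, Complex.norm_real, Real.norm_of_nonneg (hN i j)]
      exact mul_le_mul_of_nonneg_left ((div_le_iff₀ (hw j)).1 (hi j)) (hN i j)
    _ = ρ * (N *ᵥ w) i := by
      rw [Matrix.mulVec, dotProduct, Finset.mul_sum]
      exact Finset.sum_congr rfl fun j _ => by ring
    _ ≤ ρ * (t * w i) := mul_le_mul_of_nonneg_left (hNw i) hρ0.le
    _ = t * (ρ * w i) := by ring
  exact le_of_mul_le_mul_right h1 (mul_pos hρ0 (hw i))

theorem realSpectralRadius_le {N : Matrix ι ι ℝ} {t : ℝ} (ht : 0 ≤ t)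
    (h : ∀ r, (N.map Complex.ofReal).charpoly.IsRoot r → ‖r‖ ≤ t) : realSpectralRadius N ≤ t := by
  refine ENNReal.toReal_le_of_le_ofReal ht (iSup₂_le fun r hr => ?_)
  rw [← enorm_eq_nnnorm, ← ofReal_norm]
  exact ENNReal.ofReal_le_ofReal (h r (Matrix.mem_spectrum_iff_isRoot_charpoly.1 hr))

/-- A nonnegative matrix with a subinvariant positive vector has spectral radius less than one
as soon as one is not an eigenvalue. -/
theorem realSpectralRadius_lt_one {P : Matrix ι ι ℝ} (hP : EntrywiseNonneg P) {w : ι → ℝ}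
    (hw : ∀ i, 0 < w i) (hPw : ∀ i, (P *ᵥ w) i ≤ w i) (hdet : (1 - P).det ≠ 0) :
    realSpectralRadius P < 1 := by
  have hZ : IsZMatrix (1 - P) := fun i j hij => by simpa [Matrix.one_apply_ne hij] using hP i j
  set z := (1 - P)⁻¹ *ᵥ (1 : ι → ℝ) with hz
  have hMz : (1 - P) *ᵥ z = 1 := by
    rw [hz, Matrix.mulVec_mulVec, Matrix.mul_nonsing_inv _ (isUnit_iff_ne_zero.2 hdet),
      Matrix.one_mulVec]
  have hzpos : ∀ i, 0 < z i := hZ.pos_of_mulVec_pos hw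
    (fun i => by simpa [Matrix.sub_mulVec] using hPw i) (fun i => by simp [hMz])
  have hPz : ∀ i, (P *ᵥ z) i = z i - 1 := fun i => by
    have := congrFun hMz i
    simp only [Matrix.sub_mulVec, Matrix.one_mulVec, Pi.sub_apply, Pi.one_apply] at this
    linarith
  -- Since `P z = z - 1`, the bound `P z ≤ t z` needs only `(1 - t) z i ≤ 1`. The extra `1` in the
  -- denominator covers the empty index type.
  set t := 1 - 1 / (1 + ∑ i, z i) with ht
  have hs : 0 ≤ ∑ i, z i := Finset.sum_nonneg fun i _ => (hzpos i).le
  have ht0 : 0 ≤ t := by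
    rw [ht, sub_nonneg, div_le_one (by linarith)]
    linarith
  refine lt_of_le_of_lt (realSpectralRadius_le ht0 fun r hr =>
    norm_le_of_isRoot_charpoly hP hzpos (t := t) (fun i => ?_) hr) ?_
  · rw [hPz, ht, sub_mul, one_mul]
    refine sub_le_sub_left ?_ _
    rw [div_mul_eq_mul_div, one_mul, div_le_one (by linarith)]
    linarith [Finset.single_le_sum (fun i _ => (hzpos i).le) (Finset.mem_univ i)]
  · rw [ht, sub_lt_self_iff]
    positivity

theorem isNonsingularMMatrix_one_sub {P : Matrix ι ι ℝ} (hP : EntrywiseNonneg P)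
    (h : realSpectralRadius P < 1) : IsNonsingularMMatrix (1 - P) :=
  ⟨fun i j hij => by simpa [Matrix.one_apply_ne hij] using hP i j, 1, P, hP, by rw [one_smul], h⟩

/-- Each factor of `∏ (r - a)` over the eigenvalues has modulus at least `‖r‖ - t`. This
quantitative bound survives limits, so continuity of the roots is not needed. -/
theorem pow_le_norm_eval_charpoly {N : Matrix ι ι ℂ} {t : ℝ}
    (h : ∀ r, N.charpoly.IsRoot r → ‖r‖ ≤ t) {r : ℂ} (hr : t ≤ ‖r‖) :
    (‖r‖ - t) ^ Fintype.card ι ≤ ‖N.charpoly.eval r‖ := by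
  have hsplit := IsAlgClosed.splits N.charpoly
  have hcard : N.charpoly.roots.card = Fintype.card ι := by
    rw [← hsplit.natDegree_eq_card_roots, Matrix.charpoly_natDegree_eq_dim]
  rw [hsplit.eval_eq_prod_roots_of_monic N.charpoly_monic, ← hcard]
  have : ∀ s : Multiset ℂ, (∀ a ∈ s, ‖a‖ ≤ t) →
      (‖r‖ - t) ^ s.card ≤ ‖(s.map fun a => r - a).prod‖ := fun s => by
    induction s using Multiset.induction_on with
    | empty => simp
    | cons a s ih =>
      intro hs
      rw [Multiset.card_cons, Multiset.map_cons, Multiset.prod_cons, norm_mul, pow_succ']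
      refine mul_le_mul ?_ (ih fun b hb => hs b (Multiset.mem_cons_of_mem hb))
        (pow_nonneg (sub_nonneg.2 hr) _) (norm_nonneg _)
      exact (sub_le_sub_left (hs a (Multiset.mem_cons_self a s)) _).trans (norm_sub_norm_le _ _)
  exact this _ fun a ha => h a (Polynomial.isRoot_of_mem_roots ha)

/-- A bound on the eigenvalues passes to limits of matrices. -/
theorem norm_le_of_isRoot_charpoly_of_tendsto {α : Type*} {l : Filter α} [l.NeBot]
    {f : α → Matrix ι ι ℝ} {N : Matrix ι ι ℝ} (hf : Filter.Tendsto f l (nhds N)) {t : ℝ}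
    (h : ∀ᶠ a in l, ∀ r, ((f a).map Complex.ofReal).charpoly.IsRoot r → ‖r‖ ≤ t) {r : ℂ}
    (hr : (N.map Complex.ofReal).charpoly.IsRoot r) : ‖r‖ ≤ t := by
  by_contra! hlt
  have hcont : Continuous fun M : Matrix ι ι ℝ => ‖(M.map Complex.ofReal).charpoly.eval r‖ := by
    simp only [Matrix.eval_charpoly]
    exact (Continuous.matrix_det (continuous_const.sub
      (continuous_id.matrix_map Complex.continuous_ofReal))).norm
  have := ge_of_tendsto ((hcont.tendsto N).comp hf)
    (h.mono fun a ha => pow_le_norm_eval_charpoly ha hlt.le)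
  rw [hr.eq_zero, norm_zero] at this
  exact absurd this (not_le.2 (pow_pos (sub_pos.2 hlt) _))

end GeneralMatrices

/-! ### Monotone iteration for the minimal solution and the resulting spectral discs. -/

section Riccati

variable {m n : ℕ} {A : Matrix (Fin m) (Fin m) ℝ} {B : Matrix (Fin m) (Fin n) ℝ}
  {C : Matrix (Fin n) (Fin m) ℝ} {D : Matrix (Fin n) (Fin n) ℝ} {c : ℝ}

/-- One step of the fixed-point iteration for the Riccati equation of `K`, based on the splitting
`K = c I - N`, with `N` scaled by `θ`. -/
noncomputable def riccatiStep (A : Matrix (Fin m) (Fin m) ℝ) (B : Matrix (Fin m) (Fin n) ℝ)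
    (C : Matrix (Fin n) (Fin m) ℝ) (D : Matrix (Fin n) (Fin n) ℝ) (c θ : ℝ)
    (X : Matrix (Fin m) (Fin n) ℝ) : Matrix (Fin m) (Fin n) ℝ :=
  (θ / (2 * c)) • (B + X * C * X + (c • 1 - A) * X + X * (c • 1 - D))

/-- The iterates of `riccatiStep` that start from zero. -/
noncomputable def riccatiIter (A : Matrix (Fin m) (Fin m) ℝ) (B : Matrix (Fin m) (Fin n) ℝ)
    (C : Matrix (Fin n) (Fin m) ℝ) (D : Matrix (Fin n) (Fin n) ℝ) (c θ : ℝ) :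
    ℕ → Matrix (Fin m) (Fin n) ℝ
  | 0 => 0
  | k + 1 => riccatiStep A B C D c θ (riccatiIter A B C D c θ k)

theorem riccatiStep_eq_self_iff (hc : 0 < c) {X : Matrix (Fin m) (Fin n) ℝ} :
    riccatiStep A B C D c 1 X = X ↔ SolvesRiccati A B C D X := by
  have h : riccatiStep A B C D c 1 X = X + (1 / (2 * c)) • (X * C * X - X * D - A * X + B) := by
    have h2 : X = (1 / (2 * c)) • ((2 * c) • X) := by
      rw [smul_smul, one_div_mul_cancel (by positivity), one_smul]
    conv_rhs => rw [h2, ← smul_add, ← h2]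
    rw [riccatiStep]
    congr 1
    simp only [Matrix.sub_mul, Matrix.mul_sub, Matrix.smul_mul, Matrix.mul_smul, Matrix.one_mul,
      Matrix.mul_one, two_mul, add_smul]
    abel
  rw [h, SolvesRiccati, add_eq_left, smul_eq_zero]
  exact or_iff_right (by positivity)

/-- The entries of `c I - K` are nonnegative. -/
structure BlockBound (A : Matrix (Fin m) (Fin m) ℝ) (B : Matrix (Fin m) (Fin n) ℝ)
    (C : Matrix (Fin n) (Fin m) ℝ) (D : Matrix (Fin n) (Fin n) ℝ) (c : ℝ) : Prop where
  pos : 0 < c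
  left : EntrywiseNonneg (c • 1 - A)
  lower : EntrywiseNonneg B
  upper : EntrywiseNonneg C
  right : EntrywiseNonneg (c • 1 - D)

theorem BlockBound.swap (h : BlockBound A B C D c) : BlockBound D C B A c :=
  ⟨h.pos, h.right, h.upper, h.lower, h.left⟩

theorem BlockBound.riccatiStep_nonneg (h : BlockBound A B C D c) {θ : ℝ} (hθ : 0 ≤ θ)
    {X : Matrix (Fin m) (Fin n) ℝ} (hX : EntrywiseNonneg X) :
    EntrywiseNonneg (riccatiStep A B C D c θ X) :=
  (((h.lower.add ((hX.mul h.upper).mul hX)).add (h.left.mul hX)).add (hX.mul h.right)).smul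
    (div_nonneg hθ (mul_nonneg zero_le_two h.pos.le))

theorem BlockBound.riccatiIter_nonneg (h : BlockBound A B C D c) {θ : ℝ} (hθ : 0 ≤ θ) (k : ℕ) :
    EntrywiseNonneg (riccatiIter A B C D c θ k) := by
  induction k with
  | zero => exact fun _ _ => le_rfl
  | succ k ih => exact h.riccatiStep_nonneg hθ ih

theorem BlockBound.riccatiStep_mono (h : BlockBound A B C D c)
    {X Y : Matrix (Fin m) (Fin n) ℝ} (hX : EntrywiseNonneg X) (hXY : EntrywiseNonneg (Y - X)) :
    EntrywiseNonneg (riccatiStep A B C D c 1 Y - riccatiStep A B C D c 1 X) := by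
  have hY : EntrywiseNonneg Y := by simpa using hX.add hXY
  -- The quadratic term is split as `YCY - XCX = YC(Y - X) + (Y - X)CX`.
  have h1 : riccatiStep A B C D c 1 Y - riccatiStep A B C D c 1 X = (1 / (2 * c)) •
      (Y * C * (Y - X) + (Y - X) * C * X + (c • 1 - A) * (Y - X) + (Y - X) * (c • 1 - D)) := by
    rw [riccatiStep, riccatiStep, ← smul_sub]
    congr 1
    simp only [Matrix.sub_mul, Matrix.mul_sub]
    abel
  rw [h1]
  exact (((((hY.mul h.upper).mul hXY).add ((hXY.mul h.upper).mul hX)).add (h.left.mul hXY)).add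
    (hXY.mul h.right)).smul (one_div_nonneg.2 (mul_nonneg zero_le_two h.pos.le))

theorem BlockBound.riccatiIter_le (h : BlockBound A B C D c) {Y : Matrix (Fin m) (Fin n) ℝ}
    (hY : EntrywiseNonneg Y) (hYs : SolvesRiccati A B C D Y) (k : ℕ) :
    EntrywiseNonneg (Y - riccatiIter A B C D c 1 k) := by
  induction k with
  | zero => simpa [riccatiIter] using hY
  | succ k ih =>
    have := h.riccatiStep_mono (h.riccatiIter_nonneg zero_le_one k) ih
    rwa [(riccatiStep_eq_self_iff h.pos).2 hYs] at this

theorem BlockBound.riccatiIter_le_succ (h : BlockBound A B C D c) (k : ℕ) :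
    EntrywiseNonneg (riccatiIter A B C D c 1 (k + 1) - riccatiIter A B C D c 1 k) := by
  induction k with
  | zero => simpa [riccatiIter] using h.riccatiIter_nonneg zero_le_one 1
  | succ k ih => exact h.riccatiStep_mono (h.riccatiIter_nonneg zero_le_one k) ih

theorem continuous_riccatiStep (A : Matrix (Fin m) (Fin m) ℝ) (B : Matrix (Fin m) (Fin n) ℝ)
    (C : Matrix (Fin n) (Fin m) ℝ) (D : Matrix (Fin n) (Fin n) ℝ) (c : ℝ) :
    Continuous fun p : ℝ × Matrix (Fin m) (Fin n) ℝ => riccatiStep A B C D c p.1 p.2 := by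
  unfold riccatiStep
  fun_prop

theorem continuous_riccatiIter (A : Matrix (Fin m) (Fin m) ℝ) (B : Matrix (Fin m) (Fin n) ℝ)
    (C : Matrix (Fin n) (Fin m) ℝ) (D : Matrix (Fin n) (Fin n) ℝ) (c : ℝ) (k : ℕ) :
    Continuous fun θ => riccatiIter A B C D c θ k := by
  induction k with
  | zero => exact continuous_const
  | succ k ih => exact (continuous_riccatiStep A B C D c).comp (continuous_id.prodMk ih)

/-- The fixed-point iteration converges to the minimal nonnegative solution. -/
theorem BlockBound.tendsto_riccatiIter (h : BlockBound A B C D c)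
    {Φ : Matrix (Fin m) (Fin n) ℝ} (hΦ : IsMinimalNonnegSolution A B C D Φ) :
    Filter.Tendsto (riccatiIter A B C D c 1) Filter.atTop (nhds Φ) := by
  obtain ⟨hΦ0, hΦs, hΦmin⟩ := hΦ
  have hle : ∀ k i j, riccatiIter A B C D c 1 k i j ≤ Φ i j := fun k i j =>
    sub_nonneg.1 (h.riccatiIter_le hΦ0 hΦs k i j)
  have hmono : ∀ i j, Monotone fun k => riccatiIter A B C D c 1 k i j := fun i j =>
    monotone_nat_of_le_succ fun k => sub_nonneg.1 (h.riccatiIter_le_succ k i j)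
  set L : Matrix (Fin m) (Fin n) ℝ := fun i j => ⨆ k, riccatiIter A B C D c 1 k i j with hL
  have hlim : Filter.Tendsto (riccatiIter A B C D c 1) Filter.atTop (nhds L) :=
    tendsto_pi_nhds.2 fun i => tendsto_pi_nhds.2 fun j => tendsto_atTop_ciSup (hmono i j)
      ⟨Φ i j, Set.forall_mem_range.2 fun k => hle k i j⟩
  have hentry : ∀ i j, Filter.Tendsto (fun k => riccatiIter A B C D c 1 k i j) Filter.atTop
      (nhds (L i j)) := fun i j => tendsto_pi_nhds.1 (tendsto_pi_nhds.1 hlim i) j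
  have hLs : SolvesRiccati A B C D L := by
    refine (riccatiStep_eq_self_iff h.pos).1 (tendsto_nhds_unique ?_
      (hlim.comp (Filter.tendsto_add_atTop_nat 1)))
    exact ((continuous_riccatiStep A B C D c).tendsto (1, L)).comp
      (tendsto_const_nhds.prodMk_nhds hlim)
  have hL0 : EntrywiseNonneg L := fun i j =>
    ge_of_tendsto' (hentry i j) fun k => h.riccatiIter_nonneg zero_le_one k i j
  have : Φ = L := Matrix.ext fun i j => le_antisymm (hΦmin L hL0 hLs i j)
    (le_of_tendsto' (hentry i j) fun k => hle k i j)
  rwa [this]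

/-- A positive vector on which `K` is nonnegative bounds the minimal solution from the right. -/
theorem BlockBound.mulVec_le (h : BlockBound A B C D c) {Φ : Matrix (Fin m) (Fin n) ℝ}
    (hΦ : IsMinimalNonnegSolution A B C D Φ) {w₁ : Fin n → ℝ} {w₂ : Fin m → ℝ}
    (hw₂ : ∀ i, 0 ≤ w₂ i) (h₁ : ∀ i, 0 ≤ (D *ᵥ w₁ - C *ᵥ w₂) i)
    (h₂ : ∀ i, 0 ≤ (A *ᵥ w₂ - B *ᵥ w₁) i) (i : Fin m) : 0 ≤ (w₂ - Φ *ᵥ w₁) i := by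
  have hk : ∀ k i, 0 ≤ (w₂ - riccatiIter A B C D c 1 k *ᵥ w₁) i := fun k => by
    induction k with
    | zero => simpa [riccatiIter] using hw₂
    | succ k ih =>
      intro i
      have hX := h.riccatiIter_nonneg zero_le_one k
      set X := riccatiIter A B C D c 1 k
      -- The new defect is a nonnegative combination of the previous defect and the two blocks of `K
      -- w`.
      have key : w₂ - riccatiIter A B C D c 1 (k + 1) *ᵥ w₁ = (1 / (2 * c)) •
          ((A *ᵥ w₂ - B *ᵥ w₁) + (X * C) *ᵥ (w₂ - X *ᵥ w₁) + X *ᵥ (D *ᵥ w₁ - C *ᵥ w₂)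
            + (c • 1 - A) *ᵥ (w₂ - X *ᵥ w₁) + c • (w₂ - X *ᵥ w₁)) := by
        have h2 : w₂ = (1 / (2 * c)) • ((2 * c) • w₂) := by
          rw [smul_smul, one_div_mul_cancel (mul_pos two_pos h.pos).ne', one_smul]
        rw [riccatiIter, riccatiStep, Matrix.smul_mulVec]
        conv_lhs => rw [h2, ← smul_sub]
        congr 1
        simp only [Matrix.sub_mulVec, Matrix.mulVec_sub, Matrix.add_mulVec, Matrix.smul_mulVec,
          Matrix.one_mulVec, Matrix.mulVec_mulVec, Matrix.mul_sub, Matrix.sub_mul, Matrix.mul_smul,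
          Matrix.smul_mul, Matrix.mul_one, Matrix.one_mul, two_mul, add_smul, smul_sub,
          Matrix.mul_assoc]
        abel
      rw [key]
      refine mul_nonneg (one_div_nonneg.2 (mul_nonneg zero_le_two h.pos.le)) ?_
      exact add_nonneg (add_nonneg (add_nonneg (add_nonneg (h₂ i)
        ((hX.mul h.upper).mulVec_nonneg ih i)) (hX.mulVec_nonneg h₁ i))
        (h.left.mulVec_nonneg ih i)) (mul_nonneg h.pos.le (ih i))
  have hcont : Continuous fun X : Matrix (Fin m) (Fin n) ℝ => (w₂ - X *ᵥ w₁) i := by fun_prop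
  exact ge_of_tendsto' ((hcont.tendsto Φ).comp (h.tendsto_riccatiIter hΦ)) fun k => hk k i

/-- A positive vector that is subinvariant for the scaled splitting bounds the iterates from
the left. -/
theorem BlockBound.vecMul_riccatiIter_le (h : BlockBound A B C D c) {θ : ℝ} (hθ : 0 ≤ θ)
    {u₁ : Fin n → ℝ} {u₂ : Fin m → ℝ} (hu₁ : ∀ i, 0 ≤ u₁ i)
    (h₁ : ∀ i, 0 ≤ (c • u₁ - θ • (u₁ ᵥ* (c • 1 - D)) - θ • (u₂ ᵥ* B) : Fin n → ℝ) i)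
    (h₂ : ∀ i, 0 ≤ (c • u₂ - θ • (u₁ ᵥ* C) - θ • (u₂ ᵥ* (c • 1 - A)) : Fin m → ℝ) i) (k : ℕ) (i : Fin n) :
    0 ≤ (u₁ - u₂ ᵥ* riccatiIter A B C D c θ k) i := by
  induction k generalizing i with
  | zero => simpa [riccatiIter] using hu₁ i
  | succ k ih =>
    have hX := h.riccatiIter_nonneg hθ k
    set X := riccatiIter A B C D c θ k
    set e := u₁ - u₂ ᵥ* X with he
    have key : u₁ - u₂ ᵥ* riccatiIter A B C D c θ (k + 1) = (1 / (2 * c)) •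
        ((c • u₁ - θ • (u₁ ᵥ* (c • 1 - D)) - θ • (u₂ ᵥ* B)) + θ • (e ᵥ* (c • 1 - D)) + c • e
          + θ • (e ᵥ* (C * X))
          + (c • u₂ - θ • (u₁ ᵥ* C) - θ • (u₂ ᵥ* (c • 1 - A))) ᵥ* X) := by
      have h2 : u₁ = (1 / (2 * c)) • ((2 * c) • u₁) := by
        rw [smul_smul, one_div_mul_cancel (mul_pos two_pos h.pos).ne', one_smul]
      rw [riccatiIter, riccatiStep, Matrix.vecMul_smul, div_eq_mul_one_div, mul_comm, mul_smul]
      conv_lhs => rw [h2, ← smul_sub]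
      congr 1
      simp only [he, Matrix.sub_vecMul, Matrix.vecMul_sub, Matrix.vecMul_add, Matrix.vecMul_smul,
        Matrix.smul_vecMul, Matrix.vecMul_one, Matrix.vecMul_vecMul, Matrix.mul_sub,
        Matrix.sub_mul, Matrix.mul_smul, Matrix.smul_mul, Matrix.mul_one, Matrix.one_mul, two_mul,
        add_smul, smul_sub, smul_add, Matrix.mul_assoc]
      abel
    rw [key]
    refine mul_nonneg (one_div_nonneg.2 (mul_nonneg zero_le_two h.pos.le)) ?_
    exact add_nonneg (add_nonneg (add_nonneg (add_nonneg (h₁ i)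
      (mul_nonneg hθ (h.right.vecMul_nonneg ih i))) (mul_nonneg h.pos.le (ih i)))
      (mul_nonneg hθ ((h.upper.mul hX).vecMul_nonneg ih i))) (hX.vecMul_nonneg h₂ i)

/-- `K` itself may have no positive left vector `u` with `u K ≥ 0`. With `N = c I - K`, damping by
`θ < 1` gives `(c I - θN) w = c(1 - θ) w + θ K w > 0`, and strict semipositivity passes to the left
side. -/
theorem BlockBound.exists_left_subinvariant (h : BlockBound A B C D c) {w₁ : Fin n → ℝ}
    {w₂ : Fin m → ℝ} (hw₁ : ∀ i, 0 < w₁ i) (hw₂ : ∀ i, 0 < w₂ i)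
    (h₁ : ∀ i, 0 ≤ (D *ᵥ w₁ - C *ᵥ w₂) i) (h₂ : ∀ i, 0 ≤ (A *ᵥ w₂ - B *ᵥ w₁) i)
    {θ : ℝ} (hθ0 : 0 ≤ θ) (hθ1 : θ < 1) :
    ∃ (u₁ : Fin n → ℝ) (u₂ : Fin m → ℝ), (∀ i, 0 < u₁ i) ∧ (∀ i, 0 < u₂ i) ∧
      (∀ i, 0 ≤ (c • u₁ - θ • (u₁ ᵥ* (c • 1 - D)) - θ • (u₂ ᵥ* B) : Fin n → ℝ) i) ∧
      ∀ i, 0 ≤ (c • u₂ - θ • (u₁ ᵥ* C) - θ • (u₂ ᵥ* (c • 1 - A)) : Fin m → ℝ) i := by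
  set M : Matrix (Fin n ⊕ Fin m) (Fin n ⊕ Fin m) ℝ :=
    Matrix.fromBlocks (c • 1 - θ • (c • 1 - D)) (-(θ • C)) (-(θ • B)) (c • 1 - θ • (c • 1 - A))
    with hM
  have hZ : IsZMatrix M := by
    rintro (i | i) (j | j) hij
    · have hij' : i ≠ j := fun e => hij (e ▸ rfl)
      simpa [hM, Matrix.one_apply_ne hij'] using mul_nonneg hθ0 (h.right i j)
    · simpa [hM] using mul_nonneg hθ0 (h.upper i j)
    · simpa [hM] using mul_nonneg hθ0 (h.lower i j)
    · have hij' : i ≠ j := fun e => hij (e ▸ rfl)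
      simpa [hM, Matrix.one_apply_ne hij'] using mul_nonneg hθ0 (h.left i j)
  have hMw : M *ᵥ Sum.elim w₁ w₂ = Sum.elim
      ((c * (1 - θ)) • w₁ + θ • (D *ᵥ w₁ - C *ᵥ w₂))
      ((c * (1 - θ)) • w₂ + θ • (A *ᵥ w₂ - B *ᵥ w₁)) := by
    rw [hM, Matrix.fromBlocks_mulVec]
    simp only [Sum.elim_comp_inl, Sum.elim_comp_inr, Matrix.sub_mulVec, Matrix.neg_mulVec,
      Matrix.smul_mulVec, Matrix.one_mulVec]
    congr 1 <;> · ext i; simp only [Pi.add_apply, Pi.sub_apply, Pi.neg_apply, Pi.smul_apply,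
      smul_eq_mul]; ring
  have hcθ : 0 < c * (1 - θ) := mul_pos h.pos (sub_pos.2 hθ1)
  obtain ⟨u, hu, huM⟩ := hZ.exists_vecMul_pos (w := Sum.elim w₁ w₂)
    (by rintro (i | i); exacts [hw₁ i, hw₂ i])
    (by
      rw [hMw]
      rintro (i | i)
      · exact add_pos_of_pos_of_nonneg (mul_pos hcθ (hw₁ i)) (mul_nonneg hθ0 (h₁ i))
      · exact add_pos_of_pos_of_nonneg (mul_pos hcθ (hw₂ i)) (mul_nonneg hθ0 (h₂ i)))
  rw [hM, Matrix.vecMul_fromBlocks] at huM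
  refine ⟨u ∘ Sum.inl, u ∘ Sum.inr, fun i => hu _, fun i => hu _, fun i => ?_, fun i => ?_⟩
  · have := (huM (Sum.inl i)).le
    simp only [Sum.elim_inl, Matrix.vecMul_sub, Matrix.vecMul_neg, Matrix.vecMul_smul,
      Matrix.vecMul_one, Pi.add_apply, Pi.sub_apply, Pi.neg_apply, Pi.smul_apply,
      smul_eq_mul] at this ⊢
    linarith
  · have := (huM (Sum.inr i)).le
    simp only [Sum.elim_inr, Matrix.vecMul_sub, Matrix.vecMul_neg, Matrix.vecMul_smul,
      Matrix.vecMul_one, Pi.add_apply, Pi.sub_apply, Pi.neg_apply, Pi.smul_apply,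
      smul_eq_mul] at this ⊢
    linarith

/-- The eigenvalues of `A - Φ C` lie in the disc of radius `c` around `c`. -/
theorem BlockBound.norm_le_of_isRoot_charpoly_left (h : BlockBound A B C D c)
    {Φ : Matrix (Fin m) (Fin n) ℝ} (hΦ : IsMinimalNonnegSolution A B C D Φ) {w₁ : Fin n → ℝ}
    {w₂ : Fin m → ℝ} (hw₁ : ∀ i, 0 < w₁ i) (hw₂ : ∀ i, 0 < w₂ i)
    (h₁ : ∀ i, 0 ≤ (D *ᵥ w₁ - C *ᵥ w₂) i) (h₂ : ∀ i, 0 ≤ (A *ᵥ w₂ - B *ᵥ w₁) i) {r : ℂ}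
    (hr : ((c • 1 - (A - Φ * C)).map Complex.ofReal).charpoly.IsRoot r) : ‖r‖ ≤ c := by
  -- For the damped iterate, `u₂ X ≤ u₁` turns subinvariance of `(u₁, u₂)` into `θ u₂ (c I - A + X
  -- C) ≤ c u₂`.
  have hθ : ∀ k, ∀ θ ∈ Set.Ioo (0 : ℝ) 1, ∀ r : ℂ,
      ((θ • (c • 1 - A + riccatiIter A B C D c θ k * C)).map
        Complex.ofReal).charpoly.IsRoot r → ‖r‖ ≤ c := by
    rintro k θ ⟨hθ0, hθ1⟩ r hr
    obtain ⟨u₁, u₂, hu₁, hu₂, hg₁, hg₂⟩ :=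
      h.exists_left_subinvariant hw₁ hw₂ h₁ h₂ hθ0.le hθ1
    have hX := h.riccatiIter_nonneg hθ0.le k
    have hle := h.vecMul_riccatiIter_le hθ0.le (fun i => (hu₁ i).le) hg₁ hg₂ k
    set X := riccatiIter A B C D c θ k
    rw [← Matrix.charpoly_transpose, ← Matrix.transpose_map] at hr
    have hN : EntrywiseNonneg (θ • (c • 1 - A + X * C))ᵀ := fun i j =>
      (h.left.add (hX.mul h.upper)).smul hθ0.le j i
    refine norm_le_of_isRoot_charpoly hN hu₂ (fun i => ?_) hr
    rw [Matrix.mulVec_transpose]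
    have e1 := hg₂ i
    have e2 := mul_nonneg hθ0.le (h.upper.vecMul_nonneg hle i)
    simp only [Matrix.vecMul_smul, Matrix.vecMul_add, Matrix.sub_vecMul, Matrix.vecMul_vecMul,
      Pi.add_apply, Pi.sub_apply, Pi.smul_apply, smul_eq_mul] at e1 e2 ⊢
    linarith
  -- The limit `θ → 1` is taken with `k` fixed, where the iterate is continuous in `θ`; only
  -- afterwards does `k → ∞`.
  have hk : ∀ k, ∀ r : ℂ, ((c • 1 - A + riccatiIter A B C D c 1 k * C).map
      Complex.ofReal).charpoly.IsRoot r → ‖r‖ ≤ c := fun k r hr => by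
    have hcont : Continuous fun θ : ℝ => θ • (c • 1 - A + riccatiIter A B C D c θ k * C) := by
      have := continuous_riccatiIter A B C D c k
      fun_prop
    have hlim := (hcont.tendsto 1).mono_left (nhdsWithin_le_nhds (s := Set.Iio 1))
    rw [one_smul] at hlim
    exact norm_le_of_isRoot_charpoly_of_tendsto hlim
      (Filter.mem_of_superset (Ioo_mem_nhdsLT zero_lt_one) (hθ k)) hr
  have hcont : Continuous fun X : Matrix (Fin m) (Fin n) ℝ => c • 1 - A + X * C := by fun_prop
  refine norm_le_of_isRoot_charpoly_of_tendsto
    ((hcont.tendsto Φ).comp (h.tendsto_riccatiIter hΦ)) (Filter.Eventually.of_forall hk) ?_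
  rwa [sub_sub_eq_add_sub, add_sub_right_comm] at hr

/-- The eigenvalues of `D - C Φ` lie in the disc of radius `c` around `c`. -/
theorem BlockBound.norm_le_of_isRoot_charpoly_right (h : BlockBound A B C D c)
    {Φ : Matrix (Fin m) (Fin n) ℝ} (hΦ : IsMinimalNonnegSolution A B C D Φ) {w₁ : Fin n → ℝ}
    {w₂ : Fin m → ℝ} (hw₁ : ∀ i, 0 < w₁ i) (hw₂ : ∀ i, 0 < w₂ i)
    (h₁ : ∀ i, 0 ≤ (D *ᵥ w₁ - C *ᵥ w₂) i) (h₂ : ∀ i, 0 ≤ (A *ᵥ w₂ - B *ᵥ w₁) i) {r : ℂ}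
    (hr : ((c • 1 - (D - C * Φ)).map Complex.ofReal).charpoly.IsRoot r) : ‖r‖ ≤ c := by
  rw [sub_sub_eq_add_sub, add_sub_right_comm] at hr
  refine norm_le_of_isRoot_charpoly (h.right.add (h.upper.mul hΦ.1)) hw₁ (fun i => ?_) hr
  -- Here `w₁` serves directly: `CΦ w₁ ≤ C w₂ ≤ D w₁`.
  have e1 := h₁ i
  have e2 := h.upper.mulVec_nonneg (h.mulVec_le hΦ (fun i => (hw₂ i).le) h₁ h₂) i
  simp only [Matrix.add_mulVec, Matrix.sub_mulVec, Matrix.smul_mulVec, Matrix.one_mulVec,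
    Matrix.mulVec_sub, Matrix.mulVec_mulVec, Pi.add_apply, Pi.sub_apply, Pi.smul_apply,
    smul_eq_mul] at e1 e2 ⊢
  linarith

end Riccati

/-! ### Half-plane location and counting of eigenvalues. -/

section Spectrum

variable {ι κ : Type*} [Fintype ι]

theorem mulVec_re_im_eq_zero {N : Matrix κ ι ℝ} {x : ι → ℂ} (h : N.map Complex.ofReal *ᵥ x = 0) :
    (N *ᵥ fun i => (x i).re) = 0 ∧ (N *ᵥ fun i => (x i).im) = 0 := by
  constructor <;> ext k
  · have := congrArg Complex.re (congrFun h k)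
    simpa [Matrix.mulVec, dotProduct, Complex.re_sum] using this
  · have := congrArg Complex.im (congrFun h k)
    simpa [Matrix.mulVec, dotProduct, Complex.im_sum] using this

variable [DecidableEq ι]

/-- All eigenvalues have positive real part, except possibly the eigenvalue zero. -/
def SemistableSpectrum (M : Matrix ι ι ℝ) : Prop :=
  ∀ r, (M.map Complex.ofReal).charpoly.IsRoot r → 0 ≤ r.re ∧ (r.re = 0 → r = 0)

/-- The eigenvalues of `M` lie in the disc of radius `c` about `c`, which touches the imaginary axis
only at `0`. -/
theorem semistableSpectrum_of_norm_le {M : Matrix ι ι ℝ} {c : ℝ}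
    (h : ∀ r, ((c • 1 - M).map Complex.ofReal).charpoly.IsRoot r → ‖r‖ ≤ c) :
    SemistableSpectrum M := fun r hr => by
  have hc : ‖(c : ℂ) - r‖ ≤ c := by
    obtain ⟨x, hx0, hx⟩ := isRoot_charpoly_iff.1 hr
    refine h _ (isRoot_charpoly_iff.2 ⟨x, hx0, ?_⟩)
    have : (c • 1 - M).map Complex.ofReal = (c : ℂ) • 1 - M.map Complex.ofReal := by
      ext i j
      by_cases hij : i = j <;> simp [hij]
    rw [this, Matrix.sub_mulVec, hx, Matrix.smul_mulVec, Matrix.one_mulVec, sub_smul]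
  have hc0 : 0 ≤ c := (norm_nonneg _).trans hc
  have hsq : (c - r.re) * (c - r.re) + r.im * r.im ≤ c * c := by
    have := mul_self_le_mul_self (norm_nonneg _) hc
    rw [Complex.norm_mul_self_eq_normSq, Complex.normSq_apply] at this
    simpa using this
  refine ⟨?_, fun h0 => Complex.ext h0 ?_⟩
  · by_contra! hneg
    nlinarith [mul_self_nonneg r.im]
  · rw [h0] at hsq
    have : r.im * r.im = 0 := le_antisymm (by linarith) (mul_self_nonneg _)
    exact mul_self_eq_zero.1 this

theorem isRoot_charpoly_neg_iff {R : Type*} [CommRing R] [IsDomain R] {M : Matrix ι ι R} {r : R} :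
    (-M).charpoly.IsRoot r ↔ M.charpoly.IsRoot (-r) := by
  rw [isRoot_charpoly_iff, isRoot_charpoly_iff]
  refine exists_congr fun x => and_congr_right fun _ => ?_
  rw [Matrix.neg_mulVec, neg_smul, neg_eq_iff_eq_neg]

theorem charpoly_eq_of_mul_eq {R : Type*} [CommRing R] {H P Q N : Matrix ι ι R} (hPQ : P * Q = 1)
    (h : H * P = P * N) : H.charpoly = N.charpoly := by
  have hQP : Q * P = 1 := mul_eq_one_comm.1 hPQ
  have : H = P * N * Q := by rw [← h, mul_assoc, hPQ, mul_one]
  rw [this]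
  have hconj := Matrix.charpoly_units_conj ⟨P, Q, hPQ, hQP⟩ N
  rwa [← Matrix.coe_units_inv] at hconj

/-- Two factorizations of the same polynomial have the same number of roots in the right
half-plane. -/
theorem false_of_mul_eq_mul {p q p' q' : Polynomial ℂ} (hp : p.Monic) (hq : q.Monic)
    (hp' : p'.Monic) (hq' : q'.Monic) (h : p * q = p' * q') (hdeg : p.natDegree = p'.natDegree)
    (hp0 : p.IsRoot 0) (hqr : ∀ r, q.IsRoot r → r.re ≤ 0) (hpr : ∀ r, p'.IsRoot r → 0 < r.re) :
    False := by
  have hcount := congrArg (fun s : Multiset ℂ => s.countP fun r => 0 < r.re)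
    (congrArg Polynomial.roots h)
  simp only [Polynomial.roots_mul (mul_ne_zero hp.ne_zero hq.ne_zero),
    Polynomial.roots_mul (mul_ne_zero hp'.ne_zero hq'.ne_zero), Multiset.countP_add] at hcount
  -- The root `0` is not counted, so `p * q` has fewer than `deg p` roots in the open right
  -- half-plane, whereas `p'` alone has `deg p' = deg p`.
  have h1 : p.roots.countP (fun r => 0 < r.re) < p.roots.card := by
    refine lt_of_le_of_ne (Multiset.countP_le_card _ _) fun he => ?_
    have := Multiset.countP_eq_card.1 he 0 ((Polynomial.mem_roots hp.ne_zero).2 hp0)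
    simp at this
  have h2 : q.roots.countP (fun r => 0 < r.re) = 0 := Multiset.countP_eq_zero.2 fun r hr =>
    not_lt.2 (hqr r (Polynomial.isRoot_of_mem_roots hr))
  have h3 : p'.roots.countP (fun r => 0 < r.re) = p'.roots.card := Multiset.countP_eq_card.2
    fun r hr => hpr r (Polynomial.isRoot_of_mem_roots hr)
  rw [← (IsAlgClosed.splits p).natDegree_eq_card_roots] at h1
  rw [← (IsAlgClosed.splits p').natDegree_eq_card_roots] at h3
  omega

end Spectrum

/-! ### Nonsingularity of `1 - Φ Ψ` through the null spaces of `H`. -/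

section Riccati

variable {m n : ℕ} {A : Matrix (Fin m) (Fin m) ℝ} {B : Matrix (Fin m) (Fin n) ℝ}
  {C : Matrix (Fin n) (Fin m) ℝ} {D : Matrix (Fin n) (Fin n) ℝ}
  {Φ : Matrix (Fin m) (Fin n) ℝ} {Ψ : Matrix (Fin n) (Fin m) ℝ}

/-- The columns of `[I; Φ]` span an invariant subspace of `H`, on which `H` acts as `D - CΦ`. -/
theorem SolvesRiccati.charpoly_blockH (hΦ : SolvesRiccati A B C D Φ) :
    (blockH A B C D).charpoly = (D - C * Φ).charpoly * (-(A - Φ * C)).charpoly := by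
  rw [← Matrix.charpoly_fromBlocks_zero₂₁ (D - C * Φ) (-C)]
  refine charpoly_eq_of_mul_eq (P := Matrix.fromBlocks 1 0 Φ 1)
    (Q := Matrix.fromBlocks 1 0 (-Φ) 1) ?_ ?_
  · simp [Matrix.fromBlocks_multiply, ← Matrix.fromBlocks_one]
  · rw [blockH, Matrix.fromBlocks_multiply, Matrix.fromBlocks_multiply]
    congr 1
    · simp [sub_eq_add_neg]
    · simp
    · rw [← sub_eq_zero]
      refine Eq.trans ?_ hΦ
      simp only [Matrix.mul_one, Matrix.mul_zero, add_zero, Matrix.mul_sub,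
        Matrix.neg_mul, Matrix.mul_assoc]
      abel
    · simp [sub_eq_add_neg]

/-- The columns of `[Ψ; I]` span an invariant subspace of `H`, on which `H` acts as `-(A - BΨ)`. -/
theorem SolvesRiccati.charpoly_blockH_dual (hΨ : SolvesRiccati D C B A Ψ) :
    (blockH A B C D).charpoly = (D - Ψ * B).charpoly * (-(A - B * Ψ)).charpoly := by
  rw [← Matrix.charpoly_fromBlocks_zero₁₂ (D - Ψ * B) B]
  refine charpoly_eq_of_mul_eq (P := Matrix.fromBlocks 1 Ψ 0 1)
    (Q := Matrix.fromBlocks 1 (-Ψ) 0 1) ?_ ?_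
  · simp [Matrix.fromBlocks_multiply, ← Matrix.fromBlocks_one]
  · rw [blockH, Matrix.fromBlocks_multiply, Matrix.fromBlocks_multiply]
    congr 1
    · simp
    · rw [← sub_eq_zero]
      refine neg_eq_zero.1 (Eq.trans ?_ hΨ)
      simp only [Matrix.mul_one, Matrix.mul_zero, zero_add, Matrix.mul_sub,
        Matrix.mul_neg, Matrix.mul_assoc]
      abel
    · simp
    · simp [sub_eq_add_neg]

/-- If `1 - Φ Ψ` is singular, then its kernel contains a joint eigenvector. -/
theorem exists_joint_eigenvector {S T : Matrix (Fin m) (Fin m) ℂ} {R : Matrix (Fin n) (Fin n) ℂ}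
    {C Ψ : Matrix (Fin n) (Fin m) ℂ} {P : Matrix (Fin m) (Fin m) ℂ} (hdet : (1 - P).det = 0)
    (hT : T * (1 - P) = (1 - P) * S) (hR : R * Ψ = C * (1 - P) - Ψ * S) :
    ∃ x ≠ 0, ∃ r : ℂ, (1 - P) *ᵥ x = 0 ∧ S *ᵥ x = r • x ∧ R *ᵥ (Ψ *ᵥ x) = (-r) • (Ψ *ᵥ x) := by
  set V := LinearMap.ker (1 - P).mulVecLin
  have hmem : ∀ x, x ∈ V ↔ (1 - P) *ᵥ x = 0 := fun x => Iff.rfl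
  -- The intertwining relation `hT` makes the kernel `S`-invariant, so `S` has an eigenvector inside
  -- it.
  have hS : ∀ x ∈ V, S.mulVecLin x ∈ V := fun x hx => by
    rw [hmem] at hx ⊢
    rw [Matrix.mulVecLin_apply, Matrix.mulVec_mulVec, ← hT, ← Matrix.mulVec_mulVec, hx,
      Matrix.mulVec_zero]
  obtain ⟨x₀, hx₀, hx₀V⟩ := Matrix.exists_mulVec_eq_zero_iff.2 hdet
  have : Nontrivial V := ⟨⟨⟨x₀, hx₀V⟩, 0, fun h => hx₀ (congrArg Subtype.val h)⟩⟩
  obtain ⟨r, hr⟩ := Module.End.exists_eigenvalue (S.mulVecLin.restrict hS)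
  obtain ⟨⟨x, hxV⟩, hx⟩ := hr.exists_hasEigenvector
  have hSx : S *ᵥ x = r • x := congrArg Subtype.val hx.apply_eq_smul
  refine ⟨x, fun h => hx.2 (Subtype.ext h), r, hxV, hSx, ?_⟩
  rw [Matrix.mulVec_mulVec, hR, Matrix.sub_mulVec, ← Matrix.mulVec_mulVec, (hmem x).1 hxV,
    ← Matrix.mulVec_mulVec, hSx, Matrix.mulVec_zero, Matrix.mulVec_smul, zero_sub, neg_smul]

theorem exists_joint_kernel (hΦ : SolvesRiccati A B C D Φ) (hΨ : SolvesRiccati D C B A Ψ)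
    (hR : SemistableSpectrum (D - C * Φ)) (hS : SemistableSpectrum (A - B * Ψ))
    (hdet : (1 - Φ * Ψ).det = 0) :
    ∃ x ≠ 0, (Φ * Ψ) *ᵥ x = x ∧ (A - B * Ψ) *ᵥ x = 0 := by
  have hid1 : (A - Φ * C) * (1 - Φ * Ψ) = (1 - Φ * Ψ) * (A - B * Ψ) := by
    have : (A - Φ * C) * (1 - Φ * Ψ) - (1 - Φ * Ψ) * (A - B * Ψ) =
        (Φ * C * Φ - Φ * D - A * Φ + B) * Ψ - Φ * (Ψ * B * Ψ - Ψ * A - D * Ψ + C) := by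
      simp only [Matrix.mul_sub, Matrix.sub_mul, Matrix.mul_add, Matrix.add_mul, Matrix.mul_one,
        Matrix.one_mul, Matrix.mul_assoc]
      abel
    rw [← sub_eq_zero, this, hΦ, hΨ, Matrix.zero_mul, Matrix.mul_zero, sub_zero]
  have hid2 : (D - C * Φ) * Ψ = C * (1 - Φ * Ψ) - Ψ * (A - B * Ψ) := by
    have : (D - C * Φ) * Ψ - (C * (1 - Φ * Ψ) - Ψ * (A - B * Ψ)) =
        -(Ψ * B * Ψ - Ψ * A - D * Ψ + C) := by
      simp only [Matrix.mul_sub, Matrix.sub_mul, Matrix.mul_one, Matrix.mul_assoc]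
      abel
    rw [← sub_eq_zero, this, hΨ, neg_zero]
  have hmul : ∀ {a b d : ℕ} (X : Matrix (Fin a) (Fin b) ℝ) (Y : Matrix (Fin b) (Fin d) ℝ),
      (X * Y).map Complex.ofReal = X.map Complex.ofReal * Y.map Complex.ofReal :=
    fun X Y => Matrix.map_mul (f := Complex.ofRealHom)
  have hsub : ∀ {a b : ℕ} (X Y : Matrix (Fin a) (Fin b) ℝ),
      (X - Y).map Complex.ofReal = X.map Complex.ofReal - Y.map Complex.ofReal :=
    fun X Y => Matrix.map_sub Complex.ofReal Complex.ofReal_sub X Y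
  have hone : (1 : Matrix (Fin m) (Fin m) ℝ).map Complex.ofReal = 1 :=
    Matrix.map_one _ Complex.ofReal_zero Complex.ofReal_one
  have hone' : (1 - Φ * Ψ).map Complex.ofReal = 1 - (Φ * Ψ).map Complex.ofReal := by
    rw [hsub, hone]
  obtain ⟨x, hx0, r, hx, hSx, hRx⟩ := exists_joint_eigenvector
    (P := (Φ * Ψ).map Complex.ofReal) (S := (A - B * Ψ).map Complex.ofReal)
    (T := (A - Φ * C).map Complex.ofReal) (R := (D - C * Φ).map Complex.ofReal)
    (C := C.map Complex.ofReal) (Ψ := Ψ.map Complex.ofReal)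
    (by
      rw [← hone']
      exact (RingHom.map_det Complex.ofRealHom _).symm.trans (by rw [hdet, map_zero]))
    (by rw [← hone', ← hmul, ← hmul, hid1])
    (by rw [← hone', ← hmul, ← hmul, ← hmul, ← hsub, hid2])
  rw [← hone'] at hx
  have hΨx : Ψ.map Complex.ofReal *ᵥ x ≠ 0 := fun h => hx0 <| by
    rw [hone', hmul, Matrix.sub_mulVec, ← Matrix.mulVec_mulVec, h, Matrix.mulVec_zero, sub_zero,
      Matrix.one_mulVec] at hx
    exact hx
  have h1 := hS r (isRoot_charpoly_iff.2 ⟨x, hx0, hSx⟩)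
  -- Both `r` and `-r` have nonnegative real part, so `r` is purely imaginary and hence zero.
  have h2 := hR (-r) (isRoot_charpoly_iff.2 ⟨_, hΨx, hRx⟩)
  rw [Complex.neg_re] at h2
  have hr : r = 0 := h1.2 (by linarith [h1.1, h2.1])
  rw [hr, zero_smul] at hSx
  obtain ⟨hre, him⟩ := mulVec_re_im_eq_zero hx
  obtain ⟨hSre, hSim⟩ := mulVec_re_im_eq_zero hSx
  have hfix : ∀ y, (1 - Φ * Ψ) *ᵥ y = 0 → (Φ * Ψ) *ᵥ y = y := fun y hy => by
    rw [Matrix.sub_mulVec, Matrix.one_mulVec, sub_eq_zero] at hy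
    exact hy.symm
  -- With `r = 0` all relations are real, so a nonzero real or imaginary part of `x` serves as the
  -- real vector.
  by_cases h0 : (fun i => (x i).re) = 0
  · refine ⟨_, fun h0' => hx0 (funext fun i => Complex.ext (congrFun h0 i) (congrFun h0' i)),
      hfix _ him, hSim⟩
  · exact ⟨_, h0, hfix _ hre, hSre⟩

theorem blockH_mulVec (A : Matrix (Fin m) (Fin m) ℝ) (B : Matrix (Fin m) (Fin n) ℝ)
    (C : Matrix (Fin n) (Fin m) ℝ) (D : Matrix (Fin n) (Fin n) ℝ) (x : Fin n → ℝ)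
    (y : Fin m → ℝ) :
    blockH A B C D *ᵥ Sum.elim x y = Sum.elim (D *ᵥ x - C *ᵥ y) (B *ᵥ x - A *ᵥ y) := by
  rw [blockH, Matrix.fromBlocks_mulVec]
  simp [Matrix.neg_mulVec, sub_eq_add_neg]

theorem vecMul_blockH (A : Matrix (Fin m) (Fin m) ℝ) (B : Matrix (Fin m) (Fin n) ℝ)
    (C : Matrix (Fin n) (Fin m) ℝ) (D : Matrix (Fin n) (Fin n) ℝ) (x : Fin n → ℝ)
    (y : Fin m → ℝ) :
    Sum.elim x y ᵥ* blockH A B C D = Sum.elim (x ᵥ* D + y ᵥ* B) (-(x ᵥ* C) - y ᵥ* A) := by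
  rw [blockH, Matrix.vecMul_fromBlocks]
  simp [Matrix.vecMul_neg, sub_eq_add_neg]

theorem blockK_mulVec (A : Matrix (Fin m) (Fin m) ℝ) (B : Matrix (Fin m) (Fin n) ℝ)
    (C : Matrix (Fin n) (Fin m) ℝ) (D : Matrix (Fin n) (Fin n) ℝ) (x : Fin n → ℝ)
    (y : Fin m → ℝ) :
    blockK A B C D *ᵥ Sum.elim x y = Sum.elim (D *ᵥ x - C *ᵥ y) (A *ᵥ y - B *ᵥ x) := by
  rw [blockK, Matrix.fromBlocks_mulVec]
  simp [Matrix.neg_mulVec, sub_eq_add_neg, add_comm]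

theorem vecMul_blockK (A : Matrix (Fin m) (Fin m) ℝ) (B : Matrix (Fin m) (Fin n) ℝ)
    (C : Matrix (Fin n) (Fin m) ℝ) (D : Matrix (Fin n) (Fin n) ℝ) (x : Fin n → ℝ)
    (y : Fin m → ℝ) :
    Sum.elim x y ᵥ* blockK A B C D = Sum.elim (x ᵥ* D - y ᵥ* B) (y ᵥ* A - x ᵥ* C) := by
  rw [blockK, Matrix.vecMul_fromBlocks]
  simp [Matrix.vecMul_neg, sub_eq_add_neg, add_comm]

theorem sumElim_eq_zero_iff {ι κ : Type*} {x : ι → ℝ} {y : κ → ℝ} :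
    Sum.elim x y = 0 ↔ x = 0 ∧ y = 0 := by
  rw [← Sum.elim_zero_zero, Sum.elim_eq_iff]

/-- In a one-dimensional kernel, any vector is a multiple of a given nonzero vector. -/
theorem exists_smul_eq_of_finrank_ker {ι : Type*} [Fintype ι] [DecidableEq ι] {M : Matrix ι ι ℝ}
    (h : Module.finrank ℝ (LinearMap.ker M.mulVecLin) = 1) {x y : ι → ℝ} (hx0 : x ≠ 0)
    (hx : M *ᵥ x = 0) (hy : M *ᵥ y = 0) : ∃ a : ℝ, a • x = y := by
  obtain ⟨a, ha⟩ := (finrank_eq_one_iff_of_nonzero' (⟨x, hx⟩ : LinearMap.ker M.mulVecLin)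
    fun h0 => hx0 (congrArg Subtype.val h0)).1 h ⟨y, hy⟩
  exact ⟨a, congrArg Subtype.val ha⟩

/-- A square matrix and its transpose have equal rank, hence kernels of equal dimension. -/
theorem exists_smul_eq_of_finrank_ker_left {ι : Type*} [Fintype ι] [DecidableEq ι]
    {M : Matrix ι ι ℝ} (h : Module.finrank ℝ (LinearMap.ker M.mulVecLin) = 1) {x y : ι → ℝ}
    (hx0 : x ≠ 0) (hx : x ᵥ* M = 0) (hy : y ᵥ* M = 0) : ∃ a : ℝ, a • x = y := by
  refine exists_smul_eq_of_finrank_ker (M := Mᵀ) ?_ hx0 (by rwa [Matrix.mulVec_transpose])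
    (by rwa [Matrix.mulVec_transpose])
  have h1 := LinearMap.finrank_range_add_finrank_ker M.mulVecLin
  have h2 := LinearMap.finrank_range_add_finrank_ker Mᵀ.mulVecLin
  have h3 : Module.finrank ℝ (LinearMap.range Mᵀ.mulVecLin) =
    Module.finrank ℝ (LinearMap.range M.mulVecLin) := M.rank_transpose
  omega

/-- With nonzero drift the matrix `1 - Φ Ψ` is nonsingular. -/
theorem det_one_sub_mul_ne_zero (hΦ : SolvesRiccati A B C D Φ) (hΨ : SolvesRiccati D C B A Ψ)
    (hR : SemistableSpectrum (D - C * Φ)) (hS : SemistableSpectrum (A - B * Ψ))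
    (hT : SemistableSpectrum (A - Φ * C)) (hU : SemistableSpectrum (D - Ψ * B))
    (hker : Module.finrank ℝ (LinearMap.ker (blockH A B C D).mulVecLin) = 1)
    {u₁ v₁ : Fin n → ℝ} {u₂ v₂ : Fin m → ℝ} (hv_ne : Sum.elim v₁ v₂ ≠ 0)
    (hv : blockK A B C D *ᵥ Sum.elim v₁ v₂ = 0) (hu : Sum.elim u₁ u₂ ᵥ* blockK A B C D = 0)
    (hne : u₁ ⬝ᵥ v₁ ≠ u₂ ⬝ᵥ v₂) : (1 - Φ * Ψ).det ≠ 0 := fun hdet => by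
  rw [blockK_mulVec, sumElim_eq_zero_iff] at hv
  rw [vecMul_blockK, sumElim_eq_zero_iff] at hu
  obtain ⟨x, hx0, hx, hSx⟩ := exists_joint_kernel hΦ hΨ hR hS hdet
  have hdual : D * Ψ - C = -(Ψ * (A - B * Ψ)) := by
    rw [← sub_eq_zero, ← neg_eq_zero, ← hΨ]
    simp only [Matrix.mul_sub, Matrix.mul_assoc]
    abel
  have hHx : blockH A B C D *ᵥ Sum.elim (Ψ *ᵥ x) x = 0 := by
    rw [blockH_mulVec, sumElim_eq_zero_iff]
    constructor
    · rw [Matrix.mulVec_mulVec, ← Matrix.sub_mulVec, hdual, Matrix.neg_mulVec,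
        ← Matrix.mulVec_mulVec, hSx, Matrix.mulVec_zero, neg_zero]
    · rw [Matrix.mulVec_mulVec, ← Matrix.sub_mulVec, ← neg_sub, Matrix.neg_mulVec, hSx, neg_zero]
  have hHv : blockH A B C D *ᵥ Sum.elim v₁ v₂ = 0 := by
    rw [blockH_mulVec, sumElim_eq_zero_iff]
    exact ⟨hv.1, by rw [← neg_sub, hv.2, neg_zero]⟩
  obtain ⟨a, ha⟩ := exists_smul_eq_of_finrank_ker hker
    (fun h => hx0 (sumElim_eq_zero_iff.1 h).2) hHx hHv
  have hv₁ : v₁ = a • (Ψ *ᵥ x) := by ext i; exact (congrFun ha (Sum.inl i)).symm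
  have hv₂ : v₂ = a • x := by ext i; exact (congrFun ha (Sum.inr i)).symm
  have hΨv : Ψ *ᵥ v₂ = v₁ := by rw [hv₁, hv₂, Matrix.mulVec_smul]
  have hΦv : Φ *ᵥ v₁ = v₂ := by rw [hv₁, hv₂, Matrix.mulVec_smul, Matrix.mulVec_mulVec, hx]
  have hv₁0 : v₁ ≠ 0 := fun h =>
    hv_ne (sumElim_eq_zero_iff.2 ⟨h, by rw [← hΦv, h, Matrix.mulVec_zero]⟩)
  have hRv : (D - C * Φ) *ᵥ v₁ = 0 := by
    rw [Matrix.sub_mulVec, ← Matrix.mulVec_mulVec, hΦv, hv.1]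
  have hRdet : (D - C * Φ).det = 0 := Matrix.exists_mulVec_eq_zero_iff.1 ⟨v₁, hv₁0, hRv⟩
  -- This is where the drift enters: singularity would give `u₂ = u₁Ψ`, and with `Ψv₂ = v₁` the two
  -- inner products would agree.
  have hUdet : (D - Ψ * B).det ≠ 0 := fun h => by
    obtain ⟨z, hz0, hz⟩ := Matrix.exists_vecMul_eq_zero_iff.2 h
    have hHz : Sum.elim z (-(z ᵥ* Ψ)) ᵥ* blockH A B C D = 0 := by
      rw [vecMul_blockH, sumElim_eq_zero_iff]
      constructor
      · rw [← hz]
        rw [Matrix.neg_vecMul, Matrix.vecMul_sub, Matrix.vecMul_vecMul, sub_eq_add_neg]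
      · have : -C + Ψ * A = -((D - Ψ * B) * Ψ) := by
          rw [← sub_eq_zero, ← neg_eq_zero, ← hΨ]
          simp only [Matrix.sub_mul, Matrix.mul_assoc]
          abel
        rw [Matrix.neg_vecMul, sub_neg_eq_add, Matrix.vecMul_vecMul, ← Matrix.vecMul_neg,
          ← Matrix.vecMul_add, this, Matrix.vecMul_neg, ← Matrix.vecMul_vecMul, hz,
          Matrix.zero_vecMul, neg_zero]
    have hHu : Sum.elim u₁ (-u₂) ᵥ* blockH A B C D = 0 := by
      rw [vecMul_blockH, sumElim_eq_zero_iff]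
      constructor
      · rw [Matrix.neg_vecMul, ← sub_eq_add_neg, hu.1]
      · rw [Matrix.neg_vecMul, sub_neg_eq_add, neg_add_eq_sub, hu.2]
    obtain ⟨b, hb⟩ := exists_smul_eq_of_finrank_ker_left hker
      (fun h => hz0 (sumElim_eq_zero_iff.1 h).1) hHz hHu
    have hu₁ : u₁ = b • z := by ext i; exact (congrFun hb (Sum.inl i)).symm
    have hu₂ : u₂ = b • (z ᵥ* Ψ) := by
      ext i
      have := congrFun hb (Sum.inr i)
      simp only [Pi.smul_apply, Sum.elim_inr, Pi.neg_apply, smul_eq_mul, mul_neg, neg_inj] at this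
      exact this.symm
    exact hne (by
      rw [hu₁, hu₂, smul_dotProduct, smul_dotProduct, ← Matrix.dotProduct_mulVec, hΨv])
  have hmap : ∀ {k : ℕ} (M : Matrix (Fin k) (Fin k) ℝ),
      M.charpoly.map Complex.ofRealHom = (M.map Complex.ofReal).charpoly := fun M =>
    (M.charpoly_map Complex.ofRealHom).symm
  have hroot0 : ∀ {k : ℕ} (M : Matrix (Fin k) (Fin k) ℝ),
      (M.map Complex.ofReal).charpoly.IsRoot 0 ↔ M.det = 0 := fun M => by
    have h1 : (M.map Complex.ofReal).det = (M.det : ℂ) :=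
      (RingHom.map_det Complex.ofRealHom M).symm
    rw [isRoot_charpoly_iff]
    simp only [zero_smul]
    rw [Matrix.exists_mulVec_eq_zero_iff, h1, Complex.ofReal_eq_zero]
  -- On the left the first factor has the root `0`; on the right all roots of the first factor have
  -- positive real part. The half-plane count rules this out.
  have hfac : (D - C * Φ).charpoly * (-(A - Φ * C)).charpoly =
      (D - Ψ * B).charpoly * (-(A - B * Ψ)).charpoly := by
    rw [← hΦ.charpoly_blockH, hΨ.charpoly_blockH_dual]
  have hfac' := congrArg (Polynomial.map Complex.ofRealHom) hfac
  rw [Polynomial.map_mul, Polynomial.map_mul, hmap, hmap, hmap, hmap] at hfac'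
  refine false_of_mul_eq_mul (Matrix.charpoly_monic _) (Matrix.charpoly_monic _)
    (Matrix.charpoly_monic _) (Matrix.charpoly_monic _) hfac' ?_ ((hroot0 _).2 hRdet)
    (fun r hr => ?_) fun r hr => ?_
  · rw [Matrix.charpoly_natDegree_eq_dim, Matrix.charpoly_natDegree_eq_dim]
  · have hneg : (-(A - Φ * C)).map Complex.ofReal = -(A - Φ * C).map Complex.ofReal := by
      ext i j
      exact Complex.ofReal_neg _
    rw [hneg, isRoot_charpoly_neg_iff] at hr
    have := (hT _ hr).1
    rw [Complex.neg_re] at this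
    linarith
  · obtain ⟨h0, h1⟩ := hU r hr
    refine lt_of_le_of_ne h0 fun he => hUdet ((hroot0 _).1 ?_)
    rwa [h1 he.symm] at hr

theorem IsZMatrix.exists_blockBound (hK : IsZMatrix (blockK A B C D)) :
    ∃ c, BlockBound A B C D c := by
  -- Any positive number dominating all diagonal entries would do.
  set c := 1 + ((∑ i, |A i i|) + ∑ i, |D i i|) with hc
  have hA0 : 0 ≤ ∑ i, |A i i| := Finset.sum_nonneg fun i _ => abs_nonneg _
  have hD0 : 0 ≤ ∑ i, |D i i| := Finset.sum_nonneg fun i _ => abs_nonneg _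
  refine ⟨c, by rw [hc]; linarith, fun i j => ?_, fun i j => ?_, fun i j => ?_, fun i j => ?_⟩
  · by_cases hij : i = j
    · subst hij
      have := Finset.single_le_sum (fun i _ => abs_nonneg (A i i)) (Finset.mem_univ i)
      simp only [Matrix.sub_apply, Matrix.smul_apply, Matrix.one_apply_eq, smul_eq_mul, mul_one]
      linarith [le_abs_self (A i i)]
    · simpa [Matrix.one_apply_ne hij, blockK] using
        hK (Sum.inr i) (Sum.inr j) fun h => hij (Sum.inr.inj h)
  · simpa [blockK] using hK (Sum.inr i) (Sum.inl j) Sum.inr_ne_inl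
  · simpa [blockK] using hK (Sum.inl i) (Sum.inr j) Sum.inl_ne_inr
  · by_cases hij : i = j
    · subst hij
      have := Finset.single_le_sum (fun i _ => abs_nonneg (D i i)) (Finset.mem_univ i)
      simp only [Matrix.sub_apply, Matrix.smul_apply, Matrix.one_apply_eq, smul_eq_mul, mul_one]
      linarith [le_abs_self (D i i)]
    · simpa [Matrix.one_apply_ne hij, blockK] using
        hK (Sum.inl i) (Sum.inl j) fun h => hij (Sum.inl.inj h)

theorem BlockBound.mul_mulVec_le {c : ℝ} (h : BlockBound A B C D c)
    (hΦ : IsMinimalNonnegSolution A B C D Φ) (hΨ : IsMinimalNonnegSolution D C B A Ψ)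
    {w₁ : Fin n → ℝ} {w₂ : Fin m → ℝ} (hw₁ : ∀ i, 0 < w₁ i) (hw₂ : ∀ i, 0 < w₂ i)
    (h₁ : ∀ i, 0 ≤ (D *ᵥ w₁ - C *ᵥ w₂) i) (h₂ : ∀ i, 0 ≤ (A *ᵥ w₂ - B *ᵥ w₁) i) (i : Fin m) :
    ((Φ * Ψ) *ᵥ w₂) i ≤ w₂ i := by
  have e1 := h.mulVec_le hΦ (fun i => (hw₂ i).le) h₁ h₂ i
  have e2 := hΦ.1.mulVec_nonneg (h.swap.mulVec_le hΨ (fun i => (hw₁ i).le) h₂ h₁) i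
  simp only [Matrix.mulVec_sub, Matrix.mulVec_mulVec, Pi.sub_apply] at e1 e2
  linarith

end Riccati

/-! ### Assembly of the main theorem. -/

theorem mainTheorem7 {m n : ℕ}
    (A : Matrix (Fin m) (Fin m) ℝ) (B : Matrix (Fin m) (Fin n) ℝ)
    (C : Matrix (Fin n) (Fin m) ℝ) (D : Matrix (Fin n) (Fin n) ℝ)
    (hreg : IsRegularMMatrix (blockK A B C D))
    (hsing : IsSingularMMatrix (blockK A B C D))
    (hker : Module.finrank ℝ (LinearMap.ker (blockH A B C D).mulVecLin) = 1)
    (u₁ v₁ : Fin n → ℝ) (u₂ v₂ : Fin m → ℝ)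
    (hu_nonneg : ∀ i, 0 ≤ Sum.elim u₁ u₂ i) (hu_ne : Sum.elim u₁ u₂ ≠ 0)
    (hv_nonneg : ∀ i, 0 ≤ Sum.elim v₁ v₂ i) (hv_ne : Sum.elim v₁ v₂ ≠ 0)
    (hv : blockK A B C D *ᵥ Sum.elim v₁ v₂ = 0)
    (hu : Sum.elim u₁ u₂ ᵥ* blockK A B C D = 0)
    (Φ : Matrix (Fin m) (Fin n) ℝ) (Ψ : Matrix (Fin n) (Fin m) ℝ)
    (hΦ : IsMinimalNonnegSolution A B C D Φ)
    (hΨ : IsMinimalNonnegSolution D C B A Ψ)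
    (hne : u₁ ⬝ᵥ v₁ ≠ u₂ ⬝ᵥ v₂)
    (hpos : EntrywisePos Φ ∨ EntrywisePos Ψ) :
    IsNonsingularMMatrix (1 - Φ * Ψ) ∧ IsNonsingularMMatrix (1 - Ψ * Φ) ∧
      realSpectralRadius (Φ * Ψ) < 1 := by
  obtain ⟨⟨hZ, -⟩, w, hw, hKw⟩ := hreg
  obtain ⟨c, hc⟩ := hZ.exists_blockBound
  have hw₁ : ∀ i, 0 < (w ∘ Sum.inl) i := fun i => hw _
  have hw₂ : ∀ i, 0 < (w ∘ Sum.inr) i := fun i => hw _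
  rw [← Sum.elim_comp_inl_inr w, blockK_mulVec] at hKw
  have h₁ := fun i => hKw (Sum.inl i)
  have h₂ := fun i => hKw (Sum.inr i)
  simp only [Sum.elim_inl, Sum.elim_inr] at h₁ h₂
  have hdet : (1 - Φ * Ψ).det ≠ 0 := det_one_sub_mul_ne_zero hΦ.2.1 hΨ.2.1
    (semistableSpectrum_of_norm_le fun _ =>
      hc.norm_le_of_isRoot_charpoly_right hΦ hw₁ hw₂ h₁ h₂)
    (semistableSpectrum_of_norm_le fun _ =>
      hc.swap.norm_le_of_isRoot_charpoly_right hΨ hw₂ hw₁ h₂ h₁)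
    (semistableSpectrum_of_norm_le fun _ =>
      hc.norm_le_of_isRoot_charpoly_left hΦ hw₁ hw₂ h₁ h₂)
    (semistableSpectrum_of_norm_le fun _ =>
      hc.swap.norm_le_of_isRoot_charpoly_left hΨ hw₂ hw₁ h₂ h₁)
    hker hv_ne hv hu hne
  have hρ : realSpectralRadius (Φ * Ψ) < 1 := realSpectralRadius_lt_one (hΦ.1.mul hΨ.1) hw₂
    (hc.mul_mulVec_le hΦ hΨ hw₁ hw₂ h₁ h₂) hdet
  -- Exchanging `(A, B)` with `(D, C)` swaps the roles of `Φ` and `Ψ`, while Sylvester's identity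
  -- `det(I - ΨΦ) = det(I - ΦΨ)` transfers the nonsingularity.
  have hρ' : realSpectralRadius (Ψ * Φ) < 1 := realSpectralRadius_lt_one (hΨ.1.mul hΦ.1) hw₁
    (hc.swap.mul_mulVec_le hΨ hΦ hw₂ hw₁ h₂ h₁) (by rwa [Matrix.det_one_sub_mul_comm])
  exact ⟨isNonsingularMMatrix_one_sub (hΦ.1.mul hΨ.1) hρ,
    isNonsingularMMatrix_one_sub (hΨ.1.mul hΦ.1) hρ', hρ⟩
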